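/- Let $F_n$ be the free group on $n$ generators, with a fixed ordered basis $(x_1,\dots,x_n)$. For a group $G$, let $\Gamma_*(G)$ denote its lower central series: $\Gamma_1(G)=G$ and $\Gamma_{j+1}(G)=[G,\Gamma_j(G)]$. Let $IA_n$ be the group of automorphisms of $F_n$ acting trivially on the abelianization of $F_n$. For $j\ge 1$, let $\mathcal A_j$ be the group of automorphisms of $F_n$ acting trivially on $F_n/\Gamma_{j+1}(F_n)$; these groups form the Andreadakis filtration $\mathcal A_*$ of $IA_n=\mathcal A_1$. Let $IA_n^+\subseteq IA_n$ be the subgroup of triangular automorphisms, that is, of the automorphisms $\varphi$ such that for every $i$ one has $\varphi(x_i)=(w_i^{-1}x_iw_i)\,\gamma_i$ for some $w_i\in F_{i-1}$ and some $\gamma_i\in\Gamma_2(F_{i-1})$, where $F_{i-1}=\langle x_k\rangle_{k<i}$. Finally, for $j\ge 1$, let $$\mathcal A_j(IA_n^+,\Gamma_*(F_n))=\{\sigma\in IA_n^+ : \sigma(g)g^{-1}\in\Gamma_{i+j}(F_n)\text{ for all } i\ge 1 \text{ and all } g\in\Gamma_i(F_n)\}.$$ Then the subgroup of triangular automorphisms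 satisfies the Andreadakis equality, that is, for every $j\ge 1$, $$\Gamma_j(IA_n^+)=\Gamma_j(IA_n)\cap IA_n^+=\mathcal A_j\cap IA_n^+=\mathcal A_j(IA_n^+,\Gamma_*(F_n)).$$ -/

import Mathlib

/-- The lower central series `Γ_1(S) ⊇ Γ_2(S) ⊇ ⋯` of a subgroup `S` of a group `G`, with the
indexing `Γ_1(S) = S`, `Γ_{j+1}(S) = [Γ_j(S), S]` for `j ≥ 1`. All its terms are viewed as subgroups
of the ambient group `G`. It is only meant to be used for `j ≥ 1`. -/
def lcs {G : Type*} [Group G] (S : Subgroup G) (j : ℕ) : Subgroup G :=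
  S.lowerCentralSeries (j - 1)

theorem lcs_one {G : Type*} [Group G] (S : Subgroup G) : lcs S 1 = S := rfl

theorem lcs_succ {G : Type*} [Group G] (S : Subgroup G) (j : ℕ) (hj : 1 ≤ j) :
    lcs S (j + 1) = ⁅lcs S j, S⁆ := by
  obtain ⟨k, rfl⟩ := Nat.exists_eq_add_of_le' hj
  rfl

/-- The terms of the lower central series of `G` are stable under every automorphism of `G`. -/
theorem apply_mem_lcs_top {G : Type*} [Group G] (j : ℕ) (σ : MulAut G) {g : G}
    (hg : g ∈ lcs (⊤ : Subgroup G) j) : σ g ∈ lcs (⊤ : Subgroup G) j := by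
  have h := (inferInstance : ((⊤ : Subgroup G).lowerCentralSeries (j - 1)).Characteristic)
  have h2 := Subgroup.characteristic_iff_le_comap.1 h σ
  exact h2 hg

/-- `IA_G`: the group of automorphisms of `G` acting trivially on the abelianization of `G`. -/
def torelliIA (G : Type*) [Group G] : Subgroup (MulAut G) where
  carrier := {σ | ∀ g : G, Abelianization.of (σ g) = Abelianization.of g}
  one_mem' := fun _ => rfl
  mul_mem' := by
    intro σ τ hσ hτ g
    exact (hσ (τ g)).trans (hτ g)
  inv_mem' := by
    intro σ hσ g
    have h := hσ (σ⁻¹ g)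
    rw [MulAut.apply_inv_self] at h
    exact h.symm

/-- The Andreadakis filtration of `G`: `𝒜_j` is the group of automorphisms of `G` acting
trivially on the quotient `G / Γ_{j+1}(G)` (for `j ≥ 1`). -/
def andreadakis (G : Type*) [Group G] (j : ℕ) : Subgroup (MulAut G) where
  carrier := {σ | ∀ g : G, (QuotientGroup.mk (σ g) : G ⧸ lcs (⊤ : Subgroup G) (j + 1)) =
    QuotientGroup.mk g}
  one_mem' := fun _ => rfl
  mul_mem' := by
    intro σ τ hσ hτ g
    exact (hσ (τ g)).trans (hτ g)
  inv_mem' := by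
    intro σ hσ g
    have h := hσ (σ⁻¹ g)
    rw [MulAut.apply_inv_self] at h
    exact h.symm

/-- The filtration `𝒜_*(K, Γ_*(G))` of a group `K` of automorphisms of `G`: its `j`-th term
consists of the `σ ∈ K` such that `[σ, Γ_i(G)] ⊆ Γ_{i+j}(G)` for all `i ≥ 1`, where
`[σ, g] = σ(g) g⁻¹`. -/
def relAndreadakis {G : Type*} [Group G] (K : Subgroup (MulAut G)) (j : ℕ) :
    Subgroup (MulAut G) where
  carrier := {σ | σ ∈ K ∧ ∀ i : ℕ, 1 ≤ i → ∀ g ∈ lcs (⊤ : Subgroup G) i,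
    σ g * g⁻¹ ∈ lcs (⊤ : Subgroup G) (i + j)}
  one_mem' := by
    refine ⟨K.one_mem, fun i _ g _ => ?_⟩
    rw [MulAut.one_apply, mul_inv_cancel]
    exact Subgroup.one_mem _
  mul_mem' := by
    rintro σ τ ⟨hσK, hσ⟩ ⟨hτK, hτ⟩
    refine ⟨K.mul_mem hσK hτK, fun i hi g hg => ?_⟩
    have h := Subgroup.mul_mem _ (hσ i hi (τ g) (apply_mem_lcs_top i τ hg)) (hτ i hi g hg)
    rwa [mul_assoc, inv_mul_cancel_left] at h
  inv_mem' := by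
    rintro σ ⟨hσK, hσ⟩
    refine ⟨K.inv_mem hσK, fun i hi g hg => ?_⟩
    have h := Subgroup.inv_mem _ (hσ i hi (σ⁻¹ g) (apply_mem_lcs_top i σ⁻¹ hg))
    rwa [MulAut.apply_inv_self, mul_inv_rev, inv_inv] at h

section Triangular

variable {n : ℕ} {F : Type*} [Group F]

/-- The subgroup `⟨x_j⟩_{j < i}` of a free group `F` with ordered basis `x_1, …, x_n`. -/
def initialSubgroup (x : FreeGroupBasis (Fin n) F) (i : Fin n) : Subgroup F :=
  Subgroup.closure {g | ∃ j : Fin n, j < i ∧ x j = g}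

/-- `φ` is triangular with respect to the ordered basis `x_1, …, x_n`: for every `i`,
`φ(x_i) = (w⁻¹ x_i w) γ` for some `w ∈ ⟨x_j⟩_{j < i}` and `γ ∈ Γ_2(⟨x_j⟩_{j < i})`. -/
def IsTriangular (x : FreeGroupBasis (Fin n) F) (φ : MulAut F) : Prop :=
  ∀ i : Fin n, ∃ w ∈ initialSubgroup x i, ∃ γ ∈ lcs (initialSubgroup x i) 2,
    φ (x i) = (w⁻¹ * x i * w) * γ

theorem lcs_two {G : Type*} [Group G] (S : Subgroup G) : lcs S 2 = ⁅S, S⁆ := rfl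

theorem lcs_two_le {G : Type*} [Group G] (S : Subgroup G) : lcs S 2 ≤ S := by
  rw [lcs_two]
  exact Subgroup.commutator_le.2 fun a ha b hb =>
    S.mul_mem (S.mul_mem (S.mul_mem ha hb) (S.inv_mem ha)) (S.inv_mem hb)

theorem conj_mem_lcs_two {G : Type*} [Group G] {S : Subgroup G} {w γ : G} (hw : w ∈ S)
    (hγ : γ ∈ lcs S 2) : w * γ * w⁻¹ ∈ lcs S 2 := by
  have h : w * γ * w⁻¹ * γ⁻¹ ∈ lcs S 2 := by
    rw [lcs_two]
    exact Subgroup.commutator_mem_commutator hw (lcs_two_le S hγ)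
  have h2 := Subgroup.mul_mem _ h hγ
  rwa [inv_mul_cancel_right] at h2

theorem map_initialSubgroup_eq {x : FreeGroupBasis (Fin n) F} {φ : MulAut F}
    (hφ : IsTriangular x φ) (i : Fin n) :
    (initialSubgroup x i).map φ.toMonoidHom = initialSubgroup x i := by
  have mono : ∀ a b : Fin n, a ≤ b → initialSubgroup x a ≤ initialSubgroup x b := by
    intro a b hab
    refine Subgroup.closure_mono ?_
    rintro g ⟨j, hj, rfl⟩
    exact ⟨j, lt_of_lt_of_le hj hab, rfl⟩
  have gen : ∀ a b : Fin n, a < b → x a ∈ initialSubgroup x b :=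
    fun a b hab => Subgroup.subset_closure ⟨a, hab, rfl⟩
  induction i using WellFoundedLT.induction with
  | ind i ih =>
    apply le_antisymm
    · rw [Subgroup.map_le_iff_le_comap]
      refine (Subgroup.closure_le _).2 ?_
      rintro g ⟨j, hj, rfl⟩
      obtain ⟨w, hw, γ, hγ, h⟩ := hφ j
      change φ (x j) ∈ initialSubgroup x i
      rw [h]
      have hw' := mono j i hj.le hw
      exact Subgroup.mul_mem _ (Subgroup.mul_mem _ (Subgroup.mul_mem _ (Subgroup.inv_mem _ hw')
        (gen j i hj)) hw') (mono j i hj.le (lcs_two_le _ hγ))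
    · refine (Subgroup.closure_le _).2 ?_
      rintro g ⟨j, hj, rfl⟩
      obtain ⟨w, hw, γ, hγ, h⟩ := hφ j
      have hle : initialSubgroup x j ≤ (initialSubgroup x i).map φ.toMonoidHom := by
        rw [← ih j hj]
        exact Subgroup.map_mono (mono j i hj.le)
      have hx : φ (x j) ∈ (initialSubgroup x i).map φ.toMonoidHom :=
        Subgroup.mem_map_of_mem φ.toMonoidHom (gen j i hj)
      have e : x j = w * (φ (x j) * γ⁻¹) * w⁻¹ := by rw [h]; group
      change x j ∈ (initialSubgroup x i).map φ.toMonoidHom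
      rw [e]
      exact Subgroup.mul_mem _ (Subgroup.mul_mem _ (hle hw) (Subgroup.mul_mem _ hx
        (Subgroup.inv_mem _ (hle (lcs_two_le _ hγ))))) (Subgroup.inv_mem _ (hle hw))

theorem map_lcs_initialSubgroup_eq {x : FreeGroupBasis (Fin n) F} {φ : MulAut F}
    (hφ : IsTriangular x φ) (i : Fin n) (j : ℕ) :
    (lcs (initialSubgroup x i) j).map φ.toMonoidHom = lcs (initialSubgroup x i) j := by
  unfold lcs
  rw [Subgroup.map_lowerCentralSeries, map_initialSubgroup_eq hφ]

theorem inv_apply_mem_of_map_eq {S : Subgroup F} {φ : MulAut F}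
    (h : S.map φ.toMonoidHom = S) {g : F} (hg : g ∈ S) : φ⁻¹ g ∈ S := by
  rw [← h] at hg
  obtain ⟨g', hg', rfl⟩ := hg
  change φ⁻¹ (φ g') ∈ S
  rwa [MulAut.inv_apply_self]

theorem apply_mem_of_map_eq {S : Subgroup F} {φ : MulAut F}
    (h : S.map φ.toMonoidHom = S) {g : F} (hg : g ∈ S) : φ g ∈ S := by
  rw [← h]
  exact Subgroup.mem_map_of_mem φ.toMonoidHom hg

/-- `IA_n^+`: the group of triangular automorphisms of the free group `F` with ordered basis
`x_1, …, x_n`. -/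
def triangularIA (x : FreeGroupBasis (Fin n) F) : Subgroup (MulAut F) where
  carrier := {φ | IsTriangular x φ}
  one_mem' := by
    intro i
    refine ⟨1, Subgroup.one_mem _, 1, Subgroup.one_mem _, ?_⟩
    simp
  mul_mem' := by
    intro φ ψ hφ hψ i
    obtain ⟨w, hw, γ, hγ, h⟩ := hψ i
    obtain ⟨v, hv, δ, hδ, k⟩ := hφ i
    have hw' := apply_mem_of_map_eq (map_initialSubgroup_eq hφ i) hw
    have hγ' := apply_mem_of_map_eq (map_lcs_initialSubgroup_eq hφ i 2) hγ
    refine ⟨v * φ w, Subgroup.mul_mem _ hv hw', ((φ w)⁻¹ * δ * (φ w)⁻¹⁻¹) * φ γ,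
      Subgroup.mul_mem _ (conj_mem_lcs_two (Subgroup.inv_mem _ hw') hδ) hγ', ?_⟩
    rw [MulAut.mul_apply, h, map_mul, map_mul, map_mul, map_inv, k]
    group
  inv_mem' := by
    intro φ hφ i
    obtain ⟨w, hw, γ, hγ, h⟩ := hφ i
    have hw' := inv_apply_mem_of_map_eq (map_initialSubgroup_eq hφ i) hw
    have hγ' := inv_apply_mem_of_map_eq (map_lcs_initialSubgroup_eq hφ i 2) hγ
    refine ⟨(φ⁻¹ w)⁻¹, Subgroup.inv_mem _ hw', φ⁻¹ w * (φ⁻¹ γ)⁻¹ * (φ⁻¹ w)⁻¹,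
      conj_mem_lcs_two hw' (Subgroup.inv_mem _ hγ'), ?_⟩
    have e : x i = w * (φ (x i) * γ⁻¹) * w⁻¹ := by rw [h]; group
    have e2 := congrArg (fun g => φ⁻¹ g) e
    simp only [map_mul, map_inv, MulAut.inv_apply_self] at e2
    rw [e2]
    group

/-- Triangular automorphisms act trivially on the abelianization: `IA_n^+` is a subgroup of
`IA_n`. -/
theorem triangularIA_le_torelliIA (x : FreeGroupBasis (Fin n) F) :
    triangularIA x ≤ torelliIA F := by
  intro φ hφ g
  have key : (Abelianization.of (G := F)).comp φ.toMonoidHom = Abelianization.of := by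
    refine x.ext_hom _ _ fun i => ?_
    obtain ⟨w, -, γ, hγ, h⟩ := hφ i
    have hγ1 : Abelianization.of γ = 1 := by
      rw [← MonoidHom.mem_ker, Abelianization.ker_of]
      exact Subgroup.commutator_mono le_top le_top hγ
    change Abelianization.of (φ (x i)) = Abelianization.of (x i)
    rw [h, map_mul, map_mul, map_mul, hγ1, mul_one, map_inv, mul_comm, mul_inv_cancel_left]
  exact DFunLike.congr_fun key g

end Triangular

/-! ### Commutator calculus in the lower central series -/

section LowerCentralSeries

open scoped commutatorElement

variable {G : Type*} [Group G]

/-! The inclusions Γ_j(IA⁺) ⊆ Γ_j(IA) ∩ IA⁺ ⊆ 𝒜_j ∩ IA⁺ are formal, the second because 𝒜_* is a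
central filtration of IA. The content is 𝒜_j ∩ IA⁺ ⊆ Γ_j(IA⁺), which closes the circle
(`mem_lcs_triangularIA_of_forall_lt`).

A triangular automorphism is a product of factors, each moving a single x_i, to (w⁻¹ x_i w) γ. If
this is x_i modulo Γ_{j+1}(F), killing x_i and the later generators puts γ in Γ_{j+1}(F_{i-1}), and
then w⁻¹ x_i w x_i⁻¹ lies in Γ_{j+1}(F). Since w does not involve x_i, this forces w ∈ Γ_j(F_{i-1}).
Conjugations by Γ_j(F_{i-1}) and translations by Γ_{j+1}(F_{i-1}) both give elements of Γ_j(IA⁺), so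
the factor is there and can be split off.

The statement about w is read off a representation in which u⁻¹ t u t⁻¹ produces u⁻¹ - 1
(`inv_mem_dimensionSubgroup_of_conj_mul_inv_mem`). It therefore needs Magnus' theorem that dimension
subgroups of a free group are its lower central series. That theorem is proved by Lazard
elimination: a generator t of least weight is traded for the commutators [x, t, …, t], truncated at
weight k, until every weight is at least k (`eq_one_of_mem_dimensionSubgroup`). -/

instance lcs_top_normal (j : ℕ) : (lcs (⊤ : Subgroup G) j).Normal := by
  unfold lcs; infer_instance

theorem lcs_antitone (S : Subgroup G) : Antitone (lcs S) := fun _ _ h =>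
  S.lowerCentralSeries_antitone (Nat.sub_le_sub_right h 1)

theorem lcs_mono (j : ℕ) {S T : Subgroup G} (h : S ≤ T) : lcs S j ≤ lcs T j :=
  Subgroup.lowerCentralSeries_mono _ h

theorem map_lcs {H : Type*} [Group H] (f : G →* H) (S : Subgroup G) (j : ℕ) :
    (lcs S j).map f = lcs (S.map f) j :=
  Subgroup.map_lowerCentralSeries _ _ _

theorem map_lcs_top_le {H : Type*} [Group H] (f : G →* H) (j : ℕ) {g : G}
    (hg : g ∈ lcs (⊤ : Subgroup G) j) : f g ∈ lcs (⊤ : Subgroup H) j := by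
  have h := Subgroup.mem_map_of_mem f hg
  rw [map_lcs] at h
  exact lcs_mono j le_top h

/-- The three subgroups lemma modulo a normal subgroup. -/
theorem commutator_commutator_le_of_rotate {A B C N : Subgroup G} [N.Normal]
    (h₁ : ⁅⁅B, C⁆, A⁆ ≤ N) (h₂ : ⁅⁅C, A⁆, B⁆ ≤ N) : ⁅⁅A, B⁆, C⁆ ≤ N := by
  have key : ∀ P : Subgroup G, P ≤ N ↔ P.map (QuotientGroup.mk' N) = ⊥ := by
    intro P
    rw [Subgroup.map_eq_bot_iff, QuotientGroup.ker_mk']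
  rw [key, Subgroup.map_commutator, Subgroup.map_commutator] at h₁ h₂ ⊢
  exact Subgroup.commutator_commutator_eq_bot_of_rotate h₁ h₂

theorem commutator_lcs_le {i j : ℕ} (hi : 1 ≤ i) (hj : 1 ≤ j) :
    ⁅lcs (⊤ : Subgroup G) i, lcs (⊤ : Subgroup G) j⁆ ≤ lcs ⊤ (i + j) := by
  induction j, hj using Nat.le_induction generalizing i with
  | base => rw [lcs_one, lcs_succ _ _ hi]
  | succ j hj ih =>
    rw [lcs_succ _ _ hj, Subgroup.commutator_comm]
    apply commutator_commutator_le_of_rotate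
    · rw [Subgroup.commutator_comm ⊤, ← lcs_succ _ _ hi]
      exact (ih (by omega)).trans (le_of_eq (by congr 1; omega))
    · exact (Subgroup.commutator_mono (ih hi) le_rfl).trans
        (le_of_eq (lcs_succ _ _ (by omega)).symm)

theorem commutatorElement_mem_lcs {i j : ℕ} (hi : 1 ≤ i) (hj : 1 ≤ j) {g h : G}
    (hg : g ∈ lcs (⊤ : Subgroup G) i) (hh : h ∈ lcs (⊤ : Subgroup G) j) :
    ⁅g, h⁆ ∈ lcs (⊤ : Subgroup G) (i + j) :=
  commutator_lcs_le hi hj (Subgroup.commutator_mem_commutator hg hh)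

theorem mk_eq_mk_iff_mul_inv_mem {N : Subgroup G} [N.Normal] {a b : G} :
    (a : G ⧸ N) = b ↔ a * b⁻¹ ∈ N := by
  rw [← QuotientGroup.eq_one_iff, QuotientGroup.mk_mul, QuotientGroup.mk_inv, mul_inv_eq_one]

theorem mk_mul_comm_of_commutatorElement_mem {N : Subgroup G} [N.Normal] {a b : G}
    (h : ⁅a, b⁆ ∈ N) : (a : G ⧸ N) * b = b * a := by
  rw [← commutatorElement_eq_one_iff_mul_comm]
  exact (QuotientGroup.eq_one_iff _).2 h

end LowerCentralSeries

/-! ### The Andreadakis filtration is central -/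

section Andreadakis

open scoped commutatorElement

variable {G : Type*} [Group G]

theorem mem_andreadakis_iff {j : ℕ} {σ : MulAut G} :
    σ ∈ andreadakis G j ↔ ∀ g, σ g * g⁻¹ ∈ lcs (⊤ : Subgroup G) (j + 1) :=
  forall_congr' fun _ => mk_eq_mk_iff_mul_inv_mem

/-- Triviality on G/Γ_{j+1} propagates by induction on i. In σ[a, b] = [a'a, b'b], modulo Γ_{i+1+j},
the error a' is central, while b' commutes with a and with [a, b]; so both errors drop out. -/
theorem apply_mul_inv_mem_lcs_of_mem_andreadakis {j : ℕ} (hj : 1 ≤ j) {σ : MulAut G}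
    (hσ : σ ∈ andreadakis G j) {i : ℕ} (hi : 1 ≤ i) {g : G}
    (hg : g ∈ lcs (⊤ : Subgroup G) i) : σ g * g⁻¹ ∈ lcs (⊤ : Subgroup G) (i + j) := by
  rw [mem_andreadakis_iff] at hσ
  induction i, hi using Nat.le_induction generalizing g with
  | base => rw [add_comm]; exact hσ g
  | succ i hi ih =>
    let N := lcs (⊤ : Subgroup G) (i + 1 + j)
    let q := QuotientGroup.mk' N
    suffices h : lcs (⊤ : Subgroup G) (i + 1) ≤ (q.comp σ.toMonoidHom).eqLocus q from
      mk_eq_mk_iff_mul_inv_mem.1 (h hg)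
    rw [lcs_succ _ _ hi, Subgroup.commutator_le]
    intro a ha b _
    set a' := σ a * a⁻¹ with ha'
    set b' := σ b * b⁻¹ with hb'
    have h1 : a' ∈ lcs (⊤ : Subgroup G) (i + j) := ih ha
    have h2 : b' ∈ lcs (⊤ : Subgroup G) (j + 1) := hσ b
    have ea : σ a = a' * a := by rw [ha']; group
    have eb : σ b = b' * b := by rw [hb']; group
    clear_value a' b'
    have c1 : ∀ g : G, q a' * q g = q g * q a' := fun g =>
      mk_mul_comm_of_commutatorElement_mem <| lcs_antitone ⊤ (by omega)
        (commutatorElement_mem_lcs (by omega) le_rfl h1 (Subgroup.mem_top g))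
    have c2 : q b' * q a = q a * q b' :=
      mk_mul_comm_of_commutatorElement_mem <| lcs_antitone ⊤ (by omega)
        (commutatorElement_mem_lcs (by omega) hi h2 ha)
    have c3 : q b' * q ⁅a, b⁆ = q ⁅a, b⁆ * q b' :=
      mk_mul_comm_of_commutatorElement_mem <| lcs_antitone ⊤ (by omega)
        (commutatorElement_mem_lcs (i := j + 1) (j := i + 1) (by omega) (by omega) h2
          (commutatorElement_mem_lcs hi le_rfl ha (Subgroup.mem_top b)))
    change q (σ ⁅a, b⁆) = q ⁅a, b⁆
    rw [map_commutatorElement, ea, eb, map_commutatorElement, map_mul, map_mul]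
    rw [map_commutatorElement] at c3
    have e1 : ⁅q a' * q a, q b' * q b⁆ = ⁅q a, q b' * q b⁆ := by
      have h3 := c1 (a * (b' * b) * a⁻¹)
      simp only [map_mul, map_inv] at h3
      rw [commutatorElement_def, commutatorElement_def]
      calc _ = (q a' * (q a * (q b' * q b) * (q a)⁻¹)) * (q a')⁻¹ * (q b' * q b)⁻¹ := by group
        _ = _ := by rw [h3]; group
    rw [e1]
    calc ⁅q a, q b' * q b⁆ = (q a * q b') * q b * (q a)⁻¹ * (q b)⁻¹ * (q b')⁻¹ := by
          rw [commutatorElement_def]; group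
      _ = q b' * ⁅q a, q b⁆ * (q b')⁻¹ := by rw [← c2, commutatorElement_def]; group
      _ = ⁅q a, q b⁆ := by rw [c3]; group

theorem andreadakis_one : andreadakis G 1 = torelliIA G := by
  ext σ
  rw [mem_andreadakis_iff]
  refine forall_congr' fun g => ?_
  rw [← mul_inv_eq_one, ← map_inv, ← map_mul, ← MonoidHom.mem_ker, Abelianization.ker_of]
  rfl

theorem andreadakis_inf_eq_relAndreadakis (K : Subgroup (MulAut G)) {j : ℕ} (hj : 1 ≤ j) :
    andreadakis G j ⊓ K = relAndreadakis K j := by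
  apply le_antisymm
  · rintro σ ⟨hσ, hK⟩
    exact ⟨hK, fun i hi g hg => apply_mul_inv_mem_lcs_of_mem_andreadakis hj hσ hi hg⟩
  · rintro σ ⟨hK, hσ⟩
    refine ⟨mem_andreadakis_iff.2 fun g => ?_, hK⟩
    rw [add_comm]
    exact hσ 1 le_rfl g (Subgroup.mem_top g)

/-- With σh = ah and τh = bh, modulo Γ_{j+2} the automorphism σ fixes b and τ fixes a, so στh = bah
and τσh = abh; and a, b commute there. -/
theorem commutator_andreadakis_le {j : ℕ} (hj : 1 ≤ j) :
    ⁅andreadakis G j, andreadakis G 1⁆ ≤ andreadakis G (j + 1) := by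
  rw [Subgroup.commutator_le]
  intro σ hσ τ hτ g
  let q := QuotientGroup.mk' (lcs (⊤ : Subgroup G) (j + 1 + 1))
  suffices h : ∀ h, q (σ (τ h)) = q (τ (σ h)) by
    have := h (σ⁻¹ (τ⁻¹ g))
    rw [MulAut.apply_inv_self, MulAut.apply_inv_self] at this
    exact this
  intro h
  have ha := mem_andreadakis_iff.1 hσ h
  have hb := mem_andreadakis_iff.1 hτ h
  set a := σ h * h⁻¹ with ha'
  set b := τ h * h⁻¹ with hb'
  have ea : σ h = a * h := by rw [ha']; group
  have eb : τ h = b * h := by rw [hb']; group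
  clear_value a b
  have h1 : q (σ b) = q b := mk_eq_mk_iff_mul_inv_mem.2 <| lcs_antitone ⊤ (by omega)
    (apply_mul_inv_mem_lcs_of_mem_andreadakis hj hσ (by omega) hb)
  have h2 : q (τ a) = q a := mk_eq_mk_iff_mul_inv_mem.2 <| lcs_antitone ⊤ (by omega)
    (apply_mul_inv_mem_lcs_of_mem_andreadakis le_rfl hτ (by omega) ha)
  have h3 : q a * q b = q b * q a :=
    mk_mul_comm_of_commutatorElement_mem <| lcs_antitone ⊤ (by omega)
      (commutatorElement_mem_lcs (by omega) (by omega) ha hb)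
  rw [ea, eb, map_mul, map_mul, map_mul, map_mul, ea, eb, map_mul, map_mul, h1, h2,
    ← mul_assoc, ← mul_assoc, h3]

theorem lcs_torelliIA_le_andreadakis {j : ℕ} (hj : 1 ≤ j) :
    lcs (torelliIA G) j ≤ andreadakis G j := by
  induction j, hj using Nat.le_induction with
  | base => rw [andreadakis_one, lcs_one]
  | succ j hj ih =>
    rw [lcs_succ _ _ hj]
    refine (Subgroup.commutator_mono ih le_rfl).trans ?_
    rw [← andreadakis_one]
    exact commutator_andreadakis_le hj

end Andreadakis

/-! ### Weighted augmentation filtrations of free group rings -/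

namespace FreeGroupFiltration

open scoped commutatorElement

open MonoidAlgebra (of)

/-- The weighted augmentation filtration of the group ring of a free group: the finest
multiplicative decreasing filtration in which `x - 1` has weight at least `w x` for every
generator `x`. `InWeight w k r` says that `r` has weight at least `k`. -/
inductive InWeight {X : Type*} (w : X → ℕ) : ℕ → MonoidAlgebra ℤ (FreeGroup X) → Prop
  | all (r) : InWeight w 0 r
  | gen (x : X) : InWeight w (w x) (of ℤ _ (FreeGroup.of x) - 1)
  | zero (k) : InWeight w k 0
  | add {k r s} : InWeight w k r → InWeight w k s → InWeight w k (r + s)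
  | neg {k r} : InWeight w k r → InWeight w k (-r)
  | mul {i j r s} : InWeight w i r → InWeight w j s → InWeight w (i + j) (r * s)
  | mono {i j r} : i ≤ j → InWeight w j r → InWeight w i r

section Filtration

variable {X : Type*} (w : X → ℕ)

/-- The elements of weight at least `k` as an additive subgroup. -/
def weightSubgroup (k : ℕ) : AddSubgroup (MonoidAlgebra ℤ (FreeGroup X)) where
  carrier := {r | InWeight w k r}
  add_mem' := .add
  zero_mem' := .zero k
  neg_mem' := .neg

/-- The dimension subgroups attached to the weighted augmentation filtration. -/
def dimensionSubgroup (k : ℕ) : Subgroup (FreeGroup X) where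
  carrier := {g | of ℤ _ g - 1 ∈ weightSubgroup w k}
  one_mem' := by
    rw [Set.mem_ofPred_eq, map_one, sub_self]
    exact zero_mem _
  mul_mem' := by
    intro a b ha hb
    have h : of ℤ (FreeGroup X) (a * b) - 1
        = of ℤ _ a * (of ℤ _ b - 1) + (of ℤ _ a - 1) := by rw [map_mul]; noncomm_ring
    rw [Set.mem_ofPred_eq, h]
    exact add_mem (.mono (Nat.zero_add k).ge (.mul (.all _) hb)) ha
  inv_mem' := by
    intro a ha
    have h : of ℤ (FreeGroup X) a⁻¹ - 1 = -(of ℤ _ a⁻¹ * (of ℤ _ a - 1)) := by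
      rw [mul_sub, ← map_mul, inv_mul_cancel, map_one, mul_one, neg_sub]
    rw [Set.mem_ofPred_eq, h]
    exact neg_mem (.mono (Nat.zero_add k).ge (.mul (.all _) ha))

variable {w}

theorem InWeight.sub {k : ℕ} {r s} (hr : InWeight w k r) (hs : InWeight w k s) :
    InWeight w k (r - s) := sub_mem (S := AddSubgroup _) (H := weightSubgroup w k) hr hs

theorem InWeight.mul_left {k : ℕ} (r) {s} (hs : InWeight w k s) : InWeight w k (r * s) :=
  .mono (Nat.zero_add k).ge (.mul (.all r) hs)

theorem InWeight.mul_right {k : ℕ} {r} (hr : InWeight w k r) (s) : InWeight w k (r * s) :=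
  .mono (Nat.add_zero k).ge (.mul hr (.all s))

theorem mem_dimensionSubgroup {k : ℕ} {g : FreeGroup X} :
    g ∈ dimensionSubgroup w k ↔ InWeight w k (of ℤ _ g - 1) := Iff.rfl

theorem commutator_dimensionSubgroup_le (i j : ℕ) :
    ⁅dimensionSubgroup w i, dimensionSubgroup w j⁆ ≤ dimensionSubgroup w (i + j) := by
  rw [Subgroup.commutator_le]
  intro a ha b hb
  rw [mem_dimensionSubgroup] at *
  have h : of ℤ (FreeGroup X) (a * b * a⁻¹ * b⁻¹) - 1
      = ((of ℤ _ a - 1) * (of ℤ _ b - 1) - (of ℤ _ b - 1) * (of ℤ _ a - 1)) * of ℤ _ (b * a)⁻¹ := by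
    have e : (of ℤ _ a - 1) * (of ℤ _ b - 1) - (of ℤ _ b - 1) * (of ℤ _ a - 1)
      = of ℤ (FreeGroup X) (a * b) - of ℤ _ (b * a) := by
      rw [map_mul, map_mul]; noncomm_ring
    rw [e, sub_mul, ← map_mul, ← map_mul, mul_inv_cancel, map_one]
    congr 2
    group
  rw [commutatorElement_def, h]
  exact ((ha.mul hb).sub (.mono (Nat.add_comm j i).ge (hb.mul ha))).mul_right _

theorem lcs_le_dimensionSubgroup {k : ℕ} (hk : 1 ≤ k) :
    lcs (⊤ : Subgroup (FreeGroup X)) k ≤ dimensionSubgroup (fun _ => 1) k := by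
  have h1 : (⊤ : Subgroup (FreeGroup X)) ≤ dimensionSubgroup (fun _ => 1) 1 := by
    rw [← FreeGroup.closure_range_of, Subgroup.closure_le]
    rintro _ ⟨x, rfl⟩
    exact .gen x
  induction k, hk using Nat.le_induction with
  | base => exact h1
  | succ k hk ih =>
    rw [lcs_succ _ _ hk]
    exact (Subgroup.commutator_mono ih h1).trans (commutator_dimensionSubgroup_le k 1)

theorem groupRing_induction {p : MonoidAlgebra ℤ (FreeGroup X) → Prop}
    (of : ∀ g, p (MonoidAlgebra.of ℤ _ g)) (add : ∀ r s, p r → p s → p (r + s))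
    (neg : ∀ r, p r → p (-r)) (r) : p r := by
  have zero : p 0 := by
    have := add _ _ (of 1) (neg _ (of 1))
    rwa [add_neg_cancel] at this
  let S : AddSubgroup (MonoidAlgebra ℤ (FreeGroup X)) :=
    { carrier := {r | p r}, add_mem' := add _ _, zero_mem' := zero, neg_mem' := neg _ }
  induction r using MonoidAlgebra.induction_on with
  | of g => exact of g
  | add r s hr hs => exact add _ _ hr hs
  | smul n r hr => exact zsmul_mem (S := AddSubgroup _) (K := S) hr n

/-- A filtered representation of the free group is a filtered module over its group ring. -/
theorem InWeight.lift_apply_mem {M : Type*} [AddCommGroup M] (N : ℕ → AddSubgroup M)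
    (hN : Antitone N) (ρ : FreeGroup X →* Module.End ℤ M)
    (hρ : ∀ x p, ∀ m ∈ N p, ρ (FreeGroup.of x) m - m ∈ N (p + w x))
    (hρ' : ∀ x p, ∀ m ∈ N p, ρ (FreeGroup.of x)⁻¹ m ∈ N p)
    {k : ℕ} {r} (hr : InWeight w k r) {p : ℕ} {m : M} (hm : m ∈ N p) :
    MonoidAlgebra.lift ℤ _ _ ρ r m ∈ N (p + k) := by
  induction hr generalizing p m with
  | all r =>
    rw [add_zero]
    induction r using groupRing_induction with
    | of g =>
      rw [MonoidAlgebra.lift_of]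
      induction g using FreeGroup.induction_on generalizing m with
      | C1 => simpa using hm
      | of x => simpa using add_mem (hN (Nat.le_add_right _ _) (hρ x p m hm)) hm
      | inv_of x _ => exact hρ' x p m hm
      | mul g h hg hh =>
        rw [map_mul]
        exact hg (hh hm)
    | add r s hr hs =>
      rw [map_add]
      exact add_mem hr hs
    | neg r hr =>
      rw [map_neg]
      exact neg_mem hr
  | gen x =>
    rw [map_sub, MonoidAlgebra.lift_of, map_one]
    exact hρ x p m hm
  | zero k =>
    rw [map_zero]
    exact zero_mem _
  | add _ _ hr hs =>
    rw [map_add]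
    exact add_mem (hr hm) (hs hm)
  | neg _ hr =>
    rw [map_neg]
    exact neg_mem (hr hm)
  | @mul i j r s _ _ hr hs =>
    rw [map_mul, show p + (i + j) = p + j + i by omega]
    exact hr (hs hm)
  | mono hij _ hr => exact hN (Nat.add_le_add_left hij p) (hr hm)

theorem mapDomainRingHom_of {Y : Type*} (φ : FreeGroup Y →* FreeGroup X) (g : FreeGroup Y) :
    MonoidAlgebra.mapDomainRingHom ℤ φ (of ℤ _ g) = of ℤ _ (φ g) := by simp

theorem InWeight.map {Y : Type*} {v : Y → ℕ} (φ : FreeGroup Y →* FreeGroup X)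
    (hφ : ∀ y, φ (FreeGroup.of y) ∈ dimensionSubgroup w (v y)) {k : ℕ} {r}
    (hr : InWeight v k r) : InWeight w k (MonoidAlgebra.mapDomainRingHom ℤ φ r) := by
  induction hr with
  | all r => exact .all _
  | gen x =>
    rw [map_sub, mapDomainRingHom_of, map_one]
    exact hφ x
  | zero k => simpa using .zero k
  | add _ _ hr hs => simpa only [map_add] using hr.add hs
  | neg _ hr => simpa only [map_neg] using hr.neg
  | mul _ _ hr hs => simpa only [map_mul] using hr.mul hs
  | mono hij _ hr => exact hr.mono hij

/-- A twisted Leibniz rule reduces the shift by d to generators. This will make conjugation by t act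
as an operator of weight `w t`. -/
theorem InWeight.map_sub_self {d : ℕ} (φ : FreeGroup X →* FreeGroup X)
    (hφ : ∀ x, InWeight w (w x + d) (of ℤ _ (φ (FreeGroup.of x)) - of ℤ _ (FreeGroup.of x)))
    {k : ℕ} {r} (hr : InWeight w k r) :
    InWeight w (k + d) (MonoidAlgebra.mapDomainRingHom ℤ φ r - r) := by
  induction hr with
  | all r =>
    rw [zero_add]
    induction r using groupRing_induction with
    | of g =>
      suffices h : InWeight w d (of ℤ _ (φ g) - of ℤ _ g) by simpa using h
      induction g using FreeGroup.induction_on with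
      | C1 => simpa using .zero d
      | of x => exact .mono (Nat.le_add_left _ _) (hφ x)
      | inv_of x h =>
        have e : of ℤ (FreeGroup X) (φ (FreeGroup.of x)⁻¹) - of ℤ _ (FreeGroup.of x)⁻¹
            = -(of ℤ _ (φ (FreeGroup.of x)⁻¹)
              * (of ℤ _ (φ (FreeGroup.of x)) - of ℤ _ (FreeGroup.of x))
              * of ℤ _ (FreeGroup.of x)⁻¹) := by
          rw [mul_sub, sub_mul, ← map_mul, ← map_mul, ← map_mul, ← map_mul, map_inv]
          simp
        rw [e]
        exact ((h.mul_left _).mul_right _).neg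
      | mul g h hg hh =>
        have e : of ℤ (FreeGroup X) (φ (g * h)) - of ℤ _ (g * h)
            = (of ℤ _ (φ g) - of ℤ _ g) * of ℤ _ (φ h)
              + of ℤ _ g * (of ℤ _ (φ h) - of ℤ _ h) := by
          rw [map_mul, map_mul, map_mul]; noncomm_ring
        rw [e]
        exact (hg.mul_right _).add (hh.mul_left _)
    | add r s hr hs =>
      rw [map_add, add_sub_add_comm]
      exact hr.add hs
    | neg r hr =>
      rw [map_neg, neg_sub_neg, ← neg_sub]
      exact hr.neg
  | gen x =>
    rw [map_sub, mapDomainRingHom_of, map_one, sub_sub_sub_cancel_right, add_comm]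
    exact add_comm d (w x) ▸ hφ x
  | zero k => simpa using .zero _
  | add _ _ hr hs =>
    rw [map_add, add_sub_add_comm]
    exact hr.add hs
  | neg _ hr =>
    rw [map_neg, neg_sub_neg, ← neg_sub]
    exact hr.neg
  | @mul i j r s hr' hs' hr hs =>
    set T := MonoidAlgebra.mapDomainRingHom ℤ φ
    have e : T (r * s) - r * s = (T r - r) * ((T s - s) + s) + r * (T s - s) := by
      rw [map_mul]; noncomm_ring
    rw [e]
    refine .add (.mono (by omega) (hr.mul (.add (.mono (Nat.le_add_right _ _) hs) hs'))) ?_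
    exact .mono (by omega) (hr'.mul hs)
  | mono hij _ hr => exact hr.mono (Nat.add_le_add_right hij d)

end Filtration

/-- The exponent sum of the generator `t`. -/
def exponentSum {X : Type*} [DecidableEq X] (t : X) : FreeGroup X →* Multiplicative ℤ :=
  FreeGroup.lift fun x => if x = t then Multiplicative.ofAdd 1 else 1

/-- The unipotent action of `ℤ` on `R × ℤ`. -/
def transvectionHom (R : Type*) [Ring R] : Multiplicative ℤ →* Module.End ℤ (R × ℤ) where
  toFun n :=
    { toFun := fun m => (m.1 + (n.toAdd * m.2 : ℤ), m.2)
      map_add' := fun a b => by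
        refine Prod.ext ?_ rfl
        simp only [Prod.fst_add, Prod.snd_add, mul_add, Int.cast_add]
        abel
      map_smul' := fun c a => by
        refine Prod.ext ?_ rfl
        simp only [Prod.smul_fst, Prod.smul_snd, smul_add, smul_eq_mul, RingHom.id_apply,
          mul_left_comm _ c]
        rw [zsmul_eq_mul (n := c) (a := ((_ : ℤ) : R)), ← Int.cast_mul] }
  map_one' := LinearMap.ext fun m => Prod.ext (by simp) rfl
  map_mul' a b := LinearMap.ext fun m => Prod.ext (by simp [add_mul]; abel) rfl

theorem transvectionHom_apply (R : Type*) [Ring R] (n : Multiplicative ℤ) (m : R × ℤ) :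
    transvectionHom R n m = (m.1 + (n.toAdd * m.2 : ℤ), m.2) := rfl

/-- Let g act on ℤ² by the transvection given by its exponent sum, with (0, 1) in weight 0 and the
first axis in weight `w t`. Then g - 1 sends (0, 1) to (exponent sum, 0), which must vanish in
weight k > `w t`. -/
theorem exponentSum_eq_one {X : Type*} [DecidableEq X] {w : X → ℕ} {t : X} (ht : 1 ≤ w t) {k : ℕ}
    (hk : w t < k) {g : FreeGroup X} (hg : g ∈ dimensionSubgroup w k) : exponentSum t g = 1 := by
  let N : ℕ → AddSubgroup (ℤ × ℤ) := fun p =>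
    { carrier := {m | (1 ≤ p → m.2 = 0) ∧ (w t < p → m.1 = 0)}
      add_mem' := by
        rintro a b ⟨ha, ha'⟩ ⟨hb, hb'⟩
        exact ⟨fun h => by simp [ha h, hb h], fun h => by simp [ha' h, hb' h]⟩
      zero_mem' := ⟨fun _ => rfl, fun _ => rfl⟩
      neg_mem' := by
        rintro a ⟨ha, ha'⟩
        exact ⟨fun h => by simp [ha h], fun h => by simp [ha' h]⟩ }
  have hN : Antitone N := fun p q h m hm => ⟨fun h' => hm.1 (by omega), fun h' => hm.2 (by omega)⟩
  have key := InWeight.lift_apply_mem N hN ((transvectionHom ℤ).comp (exponentSum t))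
    (by
      intro x p m hm
      by_cases hx : x = t
      · subst hx
        refine ⟨fun _ => by simp [transvectionHom_apply], fun h => ?_⟩
        simpa [transvectionHom_apply, exponentSum] using hm.1 (by omega)
      · have : ((transvectionHom ℤ).comp (exponentSum t)) (FreeGroup.of x) m - m = 0 := by
          simp [exponentSum, hx]
        rw [this]
        exact zero_mem _)
    (by
      intro x p m hm
      refine ⟨hm.1, fun h => ?_⟩
      simp [transvectionHom_apply, hm.1 (by omega), hm.2 h])
    (mem_dimensionSubgroup.1 hg) (p := 0) (m := (0, 1)) ⟨by simp, by simp⟩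
  have h := key.2 (by omega)
  simp only [map_sub, MonoidAlgebra.lift_of, map_one] at h
  simpa [transvectionHom_apply] using h

/-! ### Lazard elimination and Magnus' theorem -/

section Elimination

variable {X : Type*} (w : X → ℕ) (t : X) (k : ℕ)

/-- The generators `[x, t, …, t]` of weight less than `k` obtained by eliminating `t`. -/
abbrev ElimIndex : Type _ := {p : {x // x ≠ t} × ℕ // w p.1 + p.2 * w t < k}

/-- The weights of the generators obtained by eliminating `t`. -/
def elimWeight (p : ElimIndex w t k) : ℕ := w p.1.1 + p.1.2 * w t

open Classical in
/-- The generator `[x, t, …, t]`, with `a` entries `t`; trivial if its weight is at least `k`. -/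
noncomputable def elimGen (x : {x // x ≠ t}) (a : ℕ) : FreeGroup (ElimIndex w t k) :=
  if h : w x + a * w t < k then FreeGroup.of ⟨(x, a), h⟩ else 1

/-- Conjugation by `t`. -/
noncomputable def elimConj : FreeGroup (ElimIndex w t k) →* FreeGroup (ElimIndex w t k) :=
  FreeGroup.lift fun p => elimGen w t k p.1.1 p.1.2 * elimGen w t k p.1.1 (p.1.2 + 1)

open Classical in
/-- The image of a generator under conjugation by `t⁻¹`. -/
noncomputable def elimConjInvGen (x : {x // x ≠ t}) (a : ℕ) : FreeGroup (ElimIndex w t k) :=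
  if _h : w x + a * w t < k ∧ 1 ≤ w t then
    elimGen w t k x a * (elimConjInvGen x (a + 1))⁻¹
  else 1
termination_by k - a
decreasing_by
  have := Nat.mul_le_mul_left a _h.2
  omega

/-- Conjugation by `t⁻¹`. -/
noncomputable def elimConjInv : FreeGroup (ElimIndex w t k) →* FreeGroup (ElimIndex w t k) :=
  FreeGroup.lift fun p => elimConjInvGen w t k p.1.1 p.1.2

variable {w t k}

theorem elimGen_of_not_lt {x : {x // x ≠ t}} {a : ℕ} (h : ¬ w x + a * w t < k) :
    elimGen w t k x a = 1 := dif_neg h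

theorem elimConj_elimGen (x : {x // x ≠ t}) (a : ℕ) :
    elimConj w t k (elimGen w t k x a) = elimGen w t k x a * elimGen w t k x (a + 1) := by
  by_cases h : w x + a * w t < k
  · rw [elimGen, dif_pos h]
    simp only [elimConj, FreeGroup.lift_apply_of]
    rw [elimGen, dif_pos h]
  · have h' : ¬ w x + (a + 1) * w t < k := by rw [add_mul]; omega
    rw [elimGen_of_not_lt h, elimGen_of_not_lt h', map_one, mul_one]

/-- Inverting y_a ↦ y_a y_{a+1} means solving z_a z_{a+1} = y_a; the recursion goes downwards from
the cutoff, beyond which every term is 1. -/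
theorem elimConjInvGen_eq (ht : 1 ≤ w t) (x : {x // x ≠ t}) (a : ℕ) :
    elimConjInvGen w t k x a = elimGen w t k x a * (elimConjInvGen w t k x (a + 1))⁻¹ := by
  by_cases h : w x + a * w t < k
  · rw [elimConjInvGen, dif_pos ⟨h, ht⟩]
  · have h' : ¬ w x + (a + 1) * w t < k := by rw [add_mul]; omega
    rw [elimGen_of_not_lt h, elimConjInvGen, dif_neg (fun H => h H.1), elimConjInvGen,
      dif_neg (fun H => h' H.1), inv_one, mul_one]

theorem elimConjInv_elimGen (x : {x // x ≠ t}) (a : ℕ) :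
    elimConjInv w t k (elimGen w t k x a) = elimConjInvGen w t k x a := by
  by_cases h : w x + a * w t < k
  · rw [elimGen, dif_pos h]
    simp only [elimConjInv, FreeGroup.lift_apply_of]
  · rw [elimGen_of_not_lt h, elimConjInvGen, dif_neg (fun H => h H.1), map_one]

/-- Downward induction on the number of entries `t`. -/
theorem elim_induction (ht : 1 ≤ w t) {x : {x // x ≠ t}} {P : ℕ → Prop}
    (out : ∀ a, ¬ w x + a * w t < k → P a) (step : ∀ a, P (a + 1) → P a) (a : ℕ) : P a := by
  obtain ⟨e, he⟩ : ∃ e, k ≤ a + e := ⟨k, Nat.le_add_left _ _⟩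
  induction e generalizing a with
  | zero =>
    refine out a ?_
    have := Nat.mul_le_mul_left a ht
    omega
  | succ e ih => exact step a (ih _ (by omega))

theorem elimConj_elimConjInvGen (ht : 1 ≤ w t) (x : {x // x ≠ t}) (a : ℕ) :
    elimConj w t k (elimConjInvGen w t k x a) = elimGen w t k x a := by
  induction a using elim_induction (w := w) (k := k) ht (x := x) with
  | out a h => rw [elimGen_of_not_lt h, elimConjInvGen, dif_neg (fun H => h H.1), map_one]
  | step a ih =>
    rw [elimConjInvGen_eq ht, map_mul, map_inv, ih, elimConj_elimGen, mul_inv_cancel_right]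

theorem elimGen_mk (p : ElimIndex w t k) : elimGen w t k p.1.1 p.1.2 = FreeGroup.of p :=
  dif_pos p.2

theorem elimConj_comp_elimConjInv (ht : 1 ≤ w t) :
    (elimConj w t k).comp (elimConjInv w t k) = MonoidHom.id _ := by
  ext p
  rw [MonoidHom.comp_apply, ← elimGen_mk, elimConjInv_elimGen, elimConj_elimConjInvGen ht]
  rfl

theorem elimConjInv_comp_elimConj (ht : 1 ≤ w t) :
    (elimConjInv w t k).comp (elimConj w t k) = MonoidHom.id _ := by
  ext p
  rw [MonoidHom.comp_apply, ← elimGen_mk, elimConj_elimGen, map_mul, elimConjInv_elimGen,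
    elimConjInv_elimGen, elimConjInvGen_eq ht, inv_mul_cancel_right]
  rfl

theorem elimGen_mem (x : {x // x ≠ t}) (a : ℕ) :
    elimGen w t k x a ∈ dimensionSubgroup (elimWeight w t k) (w x + a * w t) := by
  by_cases h : w x + a * w t < k
  · rw [elimGen, dif_pos h]
    exact InWeight.gen (w := elimWeight w t k) ⟨(x, a), h⟩
  · rw [elimGen_of_not_lt h]
    exact one_mem _

theorem dimensionSubgroup_antitone {Y : Type*} {v : Y → ℕ} : Antitone (dimensionSubgroup v) :=
  fun _ _ h _ hg => InWeight.mono h hg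

theorem elimConjInvGen_mem (ht : 1 ≤ w t) (x : {x // x ≠ t}) (a : ℕ) :
    elimConjInvGen w t k x a ∈ dimensionSubgroup (elimWeight w t k) (w x + a * w t) := by
  induction a using elim_induction (w := w) (k := k) ht (x := x) with
  | out a h =>
    rw [elimConjInvGen, dif_neg (fun H => h H.1)]
    exact one_mem _
  | step a ih =>
    rw [elimConjInvGen_eq ht]
    refine mul_mem (elimGen_mem x a) (inv_mem (dimensionSubgroup_antitone ?_ ih))
    rw [add_mul]
    omega

variable (w t k)

/-- Conjugation by `t` as an automorphism. -/
noncomputable def elimAut (ht : 1 ≤ w t) : MulAut (FreeGroup (ElimIndex w t k)) :=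
  MonoidHom.toMulEquiv (elimConj w t k) (elimConjInv w t k)
    (elimConjInv_comp_elimConj ht) (elimConj_comp_elimConjInv ht)

open Classical in
/-- The action of the free group on the free group on the generators obtained by eliminating `t`:
the generator `t` acts by conjugation, the other generators by left multiplication. -/
noncomputable def elimAction (ht : 1 ≤ w t) :
    FreeGroup X →* Equiv.Perm (FreeGroup (ElimIndex w t k)) :=
  FreeGroup.lift fun x =>
    if h : x ≠ t then Equiv.mulLeft (elimGen w t k ⟨x, h⟩ 0) else (elimAut w t k ht).toEquiv

/-- The linearization of an action on a set. -/
noncomputable def permRep (Y : Type*) [Group Y] :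
    Equiv.Perm Y →* Module.End ℤ (MonoidAlgebra ℤ Y) where
  toFun σ :=
    { toFun := MonoidAlgebra.mapDomain σ
      map_add' := MonoidAlgebra.mapDomain_add _
      map_smul' := fun c m => MonoidAlgebra.mapDomain_smul _ _ _ }
  map_one' := by ext; simp
  map_mul' σ τ := by ext; simp

variable {w t k}

theorem permRep_apply_of {Y : Type*} [Group Y] (σ : Equiv.Perm Y) (v : Y) :
    permRep Y σ (of ℤ _ v) = of ℤ _ (σ v) := by simp [permRep]

theorem permRep_mulLeft {Y : Type*} [Group Y] (y : Y) (r : MonoidAlgebra ℤ Y) :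
    permRep Y (Equiv.mulLeft y) r = of ℤ _ y * r := by
  have h : permRep Y (Equiv.mulLeft y) = LinearMap.mulLeft ℤ (of ℤ _ y) := by
    ext v
    simp [permRep]
  rw [h, LinearMap.mulLeft_apply]

theorem elimAction_of_ne (ht : 1 ≤ w t) {x : X} (hx : x ≠ t) :
    elimAction w t k ht (FreeGroup.of x) = Equiv.mulLeft (elimGen w t k ⟨x, hx⟩ 0) := by
  rw [elimAction, FreeGroup.lift_apply_of, dif_pos hx]

theorem elimAction_of_self (ht : 1 ≤ w t) :
    elimAction w t k ht (FreeGroup.of t) = (elimAut w t k ht).toEquiv := by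
  rw [elimAction, FreeGroup.lift_apply_of, dif_neg (fun h => h rfl)]

/-- The element of the eliminated free group attached to an element of the `k'`-th dimension
subgroup lies in the `k'`-th dimension subgroup. -/
theorem elimAction_apply_one_mem (ht : 1 ≤ w t) {k' : ℕ} {g : FreeGroup X}
    (hg : g ∈ dimensionSubgroup w k') :
    elimAction w t k ht g 1 ∈ dimensionSubgroup (elimWeight w t k) k' := by
  have key := InWeight.lift_apply_mem (weightSubgroup (elimWeight w t k))
    (fun _ _ h _ hr => InWeight.mono h hr) ((permRep _).comp (elimAction w t k ht))
    (by
      intro x p m hm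
      rw [MonoidHom.comp_apply]
      by_cases hx : x = t
      · subst hx
        rw [elimAction_of_self]
        -- A generator y_a moves by y_a (y_{a+1} - 1), whose weight exceeds that of y_a by `w x`,
        -- here the weight of the eliminated generator.
        refine InWeight.map_sub_self (elimConj w x k) (fun q => ?_) hm
        rw [← elimGen_mk, elimConj_elimGen, map_mul]
        have h := elimGen_mem (w := w) (k := k) q.1.1 (q.1.2 + 1)
        rw [add_mul, one_mul, ← add_assoc, mem_dimensionSubgroup] at h
        have := h.mul_left (of ℤ _ (elimGen w x k q.1.1 q.1.2))
        rwa [mul_sub, mul_one] at this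
      · rw [elimAction_of_ne ht hx, permRep_mulLeft]
        have h := elimGen_mem (w := w) (t := t) (k := k) ⟨x, hx⟩ 0
        rw [zero_mul, add_zero] at h
        have := (mem_dimensionSubgroup.1 h).mul hm
        rw [sub_mul, one_mul, add_comm] at this
        exact this)
    (by
      intro x p m hm
      rw [MonoidHom.comp_apply, map_inv]
      by_cases hx : x = t
      · subst hx
        rw [elimAction_of_self]
        refine InWeight.map (elimConjInv w x k) (fun q => ?_) hm
        rw [← elimGen_mk, elimConjInv_elimGen]
        exact elimConjInvGen_mem ht _ _
      · rw [elimAction_of_ne ht hx, Equiv.Perm.inv_def, Equiv.mulLeft_symm, permRep_mulLeft]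
        exact InWeight.mul_left _ hm)
    (mem_dimensionSubgroup.1 hg) (p := 0) (m := 1) (.all _)
  rw [map_sub, MonoidAlgebra.lift_of, LinearMap.sub_apply, zero_add, MonoidHom.comp_apply,
    map_one (MonoidAlgebra.lift _ _ _ _), Module.End.one_apply] at key
  have h := permRep_apply_of (elimAction w t k ht g) 1
  rw [map_one (of ℤ (FreeGroup (ElimIndex w t k)))] at h
  rwa [h] at key

variable {G : Type*} [Group G]

/-- The iterated commutators `[g, s, …, s]`. -/
def iterCommutator (g s : G) : ℕ → G
  | 0 => g
  | a + 1 => ⁅(iterCommutator g s a)⁻¹, s⁆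

theorem iterCommutator_mem {i j : ℕ} (hi : 1 ≤ i) (hj : 1 ≤ j) {g s : G}
    (hg : g ∈ lcs (⊤ : Subgroup G) i) (hs : s ∈ lcs (⊤ : Subgroup G) j) (a : ℕ) :
    iterCommutator g s a ∈ lcs (⊤ : Subgroup G) (i + a * j) := by
  induction a with
  | zero => simpa [iterCommutator] using hg
  | succ a ih =>
    rw [add_mul, one_mul, ← add_assoc]
    exact commutatorElement_mem_lcs (by omega) hj (inv_mem ih) hs

/-- The identity that `elimConj` imitates; the inverse in `iterCommutator` is there to make it hold.
-/
theorem conj_iterCommutator (g s : G) (a : ℕ) :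
    s * iterCommutator g s a * s⁻¹ = iterCommutator g s a * iterCommutator g s (a + 1) := by
  rw [iterCommutator, commutatorElement_def]
  group

variable (k) in
/-- The homomorphism induced on the eliminated free group. -/
noncomputable def elimLift (f : FreeGroup X →* G) : FreeGroup (ElimIndex w t k) →* G :=
  FreeGroup.lift fun p =>
    iterCommutator (f (FreeGroup.of p.1.1.1)) (f (FreeGroup.of t)) p.1.2

/-- Truncation is harmless: the discarded commutators have image in Γ_k(G) = 1. -/
theorem elimLift_elimGen (hk : lcs (⊤ : Subgroup G) k = ⊥) (hw : ∀ x, 1 ≤ w x)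
    {f : FreeGroup X →* G} (hf : ∀ x, f (FreeGroup.of x) ∈ lcs (⊤ : Subgroup G) (w x))
    (x : {x // x ≠ t}) (a : ℕ) :
    elimLift k f (elimGen w t k x a)
      = iterCommutator (f (FreeGroup.of x.1)) (f (FreeGroup.of t)) a := by
  by_cases h : w x + a * w t < k
  · rw [elimGen, dif_pos h, elimLift, FreeGroup.lift_apply_of]
  · rw [elimGen_of_not_lt h, map_one]
    have := lcs_antitone ⊤ (not_lt.1 h) (iterCommutator_mem (hw _) (hw t) (hf x) (hf t) a)
    rw [hk, Subgroup.mem_bot] at this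
    exact this.symm

theorem elimLift_elimConj (hk : lcs (⊤ : Subgroup G) k = ⊥) (hw : ∀ x, 1 ≤ w x)
    {f : FreeGroup X →* G} (hf : ∀ x, f (FreeGroup.of x) ∈ lcs (⊤ : Subgroup G) (w x))
    (v : FreeGroup (ElimIndex w t k)) :
    elimLift k f (elimConj w t k v)
      = f (FreeGroup.of t) * elimLift k f v * (f (FreeGroup.of t))⁻¹ := by
  suffices h : (elimLift k f).comp (elimConj w t k)
      = (MulAut.conj (f (FreeGroup.of t))).toMonoidHom.comp (elimLift k f) from
    DFunLike.congr_fun h v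
  ext p
  simp only [MonoidHom.comp_apply, ← elimGen_mk]
  rw [elimConj_elimGen, map_mul, elimLift_elimGen hk hw hf, elimLift_elimGen hk hw hf,
    ← conj_iterCommutator]
  rfl

-- At v = 1 this is the image in G of the decomposition of g as an element of the eliminated group
-- times a power of t.
open Classical in
theorem elimLift_elimAction (hk : lcs (⊤ : Subgroup G) k = ⊥) (hw : ∀ x, 1 ≤ w x)
    {f : FreeGroup X →* G} (hf : ∀ x, f (FreeGroup.of x) ∈ lcs (⊤ : Subgroup G) (w x))
    (g : FreeGroup X) (v : FreeGroup (ElimIndex w t k)) :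
    elimLift k f (elimAction w t k (hw t) g v)
      = f g * elimLift k f v * f (FreeGroup.of t) ^ (-(exponentSum t g).toAdd) := by
  induction g using FreeGroup.induction_on generalizing v with
  | C1 => simp
  | of x =>
    by_cases hx : x = t
    · subst hx
      rw [elimAction_of_self]
      refine (elimLift_elimConj hk hw hf v).trans ?_
      simp [exponentSum]
    · rw [elimAction_of_ne _ hx, Equiv.coe_mulLeft, map_mul, elimLift_elimGen hk hw hf]
      simp [exponentSum, hx, iterCommutator]
  | inv_of x h =>
    have h' := h ((elimAction w t k (hw t) (FreeGroup.of x))⁻¹ v)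
    rw [Equiv.Perm.inv_def, Equiv.apply_symm_apply] at h'
    rw [map_inv, h']
    simp [mul_assoc]
  | mul g h hg hh =>
    rw [map_mul, Equiv.Perm.mul_apply, hg, hh]
    simp only [map_mul, toAdd_mul, neg_add_rev, zpow_add, mul_assoc]

/-- A free group satisfies the dimension property, in a weighted form. -/
theorem eq_one_of_mem_dimensionSubgroup {G : Type*} [Group G] {k : ℕ}
    (hk : lcs (⊤ : Subgroup G) k = ⊥) {X : Type*} [Finite X] {w : X → ℕ} (hw : ∀ x, 1 ≤ w x)
    {f : FreeGroup X →* G} (hf : ∀ x, f (FreeGroup.of x) ∈ lcs (⊤ : Subgroup G) (w x))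
    {g : FreeGroup X} (hg : g ∈ dimensionSubgroup w k) : f g = 1 := by
  -- Outer induction: e bounds the gap between k and the least weight.
  obtain ⟨e, he⟩ : ∃ e, ∀ x, k ≤ w x + e := ⟨k, fun x => Nat.le_add_left _ _⟩
  induction e generalizing X with
  | zero =>
    have h : f = 1 := by
      ext x
      have := lcs_antitone ⊤ (he x) (hf x)
      rwa [hk, Subgroup.mem_bot] at this
    rw [h, MonoidHom.one_apply]
  | succ e ihe =>
    -- Inner induction on the number of generators of the least allowed weight k - e - 1.
    obtain ⟨N, hN⟩ : ∃ N, Nat.card {x // w x + e < k} ≤ N := ⟨_, le_rfl⟩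
    induction N generalizing X with
    | zero =>
      refine ihe hw hf hg fun x => ?_
      by_contra hx
      have : Nonempty {x // w x + e < k} := ⟨⟨x, by omega⟩⟩
      have := Nat.card_pos (α := {x // w x + e < k})
      omega
    | succ N ihN =>
      by_cases hX : ∀ x, k ≤ w x + e
      · exact ihe hw hf hg hX
      push Not at hX
      obtain ⟨t, ht⟩ := hX
      have ht1 := hw t
      have hfin : Finite (ElimIndex w t k) := by
        have hlt : ∀ p : ElimIndex w t k, p.1.2 < k := fun p => by
          have := Nat.mul_le_mul_left p.1.2 ht1
          have := p.2
          omega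
        refine Finite.of_injective
          (fun p : ElimIndex w t k => ((p.1.1, ⟨p.1.2, hlt p⟩) : {x // x ≠ t} × Fin k)) ?_
        rintro ⟨⟨x, a⟩, _⟩ ⟨⟨y, b⟩, _⟩ h
        simpa using h
      have hcard : Nat.card {p // elimWeight w t k p + e < k} ≤ N := by
        -- A commutator with at least one entry t weighs at least `w x + w t`, more than the
        -- minimum; only old generators other than t can have least weight.
        have hzero : ∀ p, elimWeight w t k p + e < k → p.1.2 = 0 := by
          intro p hp
          by_contra h0
          have h1 := Nat.mul_le_mul_right (w t) (Nat.one_le_iff_ne_zero.2 h0)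
          have h2 := he t
          have h3 := hw p.1.1
          rw [elimWeight] at hp
          omega
        -- The extra point goes to t, so the count drops strictly.
        let ι : Option {p // elimWeight w t k p + e < k} → {x // w x + e < k} := fun o =>
          o.elim ⟨t, ht⟩ fun p => ⟨p.1.1.1, by
            have := p.2
            rw [elimWeight] at this
            omega⟩
        have hι : Function.Injective ι := by
          rintro (_ | p) (_ | q) h
          · rfl
          · exact absurd (congrArg Subtype.val h).symm q.1.1.1.2
          · exact absurd (congrArg Subtype.val h) p.1.1.1.2
          · have h1 := congrArg Subtype.val h
            congr 1
            exact Subtype.ext (Subtype.ext (Prod.ext (Subtype.ext h1)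
              ((hzero _ p.2).trans (hzero _ q.2).symm)))
        have := Nat.card_le_card_of_injective ι hι
        rw [Finite.card_option] at this
        omega
      have key := ihN (X := ElimIndex w t k) (w := elimWeight w t k)
        (fun p => (hw _).trans (Nat.le_add_right _ _)) (f := elimLift k f)
        (fun p => by
          rw [elimLift, FreeGroup.lift_apply_of]
          exact iterCommutator_mem (hw _) (hw t) (hf _) (hf t) _)
        (elimAction_apply_one_mem ht1 hg)
        (fun p => (he p.1.1).trans (Nat.add_le_add_right (Nat.le_add_right _ _) _)) hcard
      classical
      rw [elimLift_elimAction hk hw hf, exponentSum_eq_one ht1 (by omega) hg] at key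
      simpa using key

end Elimination

/-- Magnus' theorem: in a free group of finite rank, the integral dimension subgroups are the terms
of the lower central series. -/
theorem dimensionSubgroup_le_lcs {X : Type*} [Finite X] (k : ℕ) :
    dimensionSubgroup (X := X) (fun _ => 1) k ≤ lcs ⊤ k := by
  intro g hg
  let q := QuotientGroup.mk' (lcs (⊤ : Subgroup (FreeGroup X)) k)
  have hbot : lcs (⊤ : Subgroup (FreeGroup X ⧸ lcs (⊤ : Subgroup (FreeGroup X)) k)) k = ⊥ := by
    have h := map_lcs q ⊤ k
    rw [← MonoidHom.range_eq_map, MonoidHom.range_eq_top.2 (QuotientGroup.mk'_surjective _)] at h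
    rw [← h, Subgroup.map_eq_bot_iff, QuotientGroup.ker_mk']
  have := eq_one_of_mem_dimensionSubgroup hbot (fun _ => le_rfl) (f := q)
    (fun x => Subgroup.mem_top _) hg
  exact (QuotientGroup.eq_one_iff g).1 this

/-! ### Elements almost commuting with a basis element -/

section Centralizer

variable {X : Type*}

/-- The action of the free group by left multiplication on the first factor of `ℤ[F] × ℤ`. -/
noncomputable def mulLeftHom (X : Type*) :
    FreeGroup X →* Module.End ℤ (MonoidAlgebra ℤ (FreeGroup X) × ℤ) where
  toFun g := LinearMap.prodMap (LinearMap.mulLeft ℤ (of ℤ _ g)) LinearMap.id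
  map_one' := LinearMap.ext fun m => Prod.ext (by rw [map_one]; exact one_mul _) rfl
  map_mul' a b := LinearMap.ext fun m =>
    Prod.ext (by rw [map_mul]; exact mul_assoc _ _ _) rfl

theorem mulLeftHom_apply (g : FreeGroup X) (m : MonoidAlgebra ℤ (FreeGroup X) × ℤ) :
    mulLeftHom X g m = (of ℤ _ g * m.1, m.2) := rfl

open Classical in
/-- The action of the free group on `ℤ[F] × ℤ` in which the generator `t` acts as a transvection,
and the other generators by left multiplication. -/
noncomputable def magnusRep (t : X) :
    FreeGroup X →* Module.End ℤ (MonoidAlgebra ℤ (FreeGroup X) × ℤ) :=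
  (Units.coeHom _).comp <| FreeGroup.lift fun x =>
    if x = t then (transvectionHom _).toHomUnits (.ofAdd 1) else
      (mulLeftHom X).toHomUnits (FreeGroup.of x)

theorem magnusRep_of_self (t : X) :
    magnusRep t (FreeGroup.of t) = transvectionHom _ (.ofAdd 1) := by
  simp [magnusRep]

theorem magnusRep_inv_of_self (t : X) :
    magnusRep t (FreeGroup.of t)⁻¹ = transvectionHom _ (.ofAdd (-1)) := by
  have h : magnusRep t (FreeGroup.of t)⁻¹
      = (((transvectionHom (MonoidAlgebra ℤ (FreeGroup X))).toHomUnits (.ofAdd 1))⁻¹ : Units _) := by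
    simp [magnusRep]
  rw [h, ← map_inv]
  rfl

theorem magnusRep_of_mem {t : X} {u : FreeGroup X}
    (hu : u ∈ Subgroup.closure {g | ∃ x ≠ t, FreeGroup.of x = g}) :
    magnusRep t u = mulLeftHom X u := by
  have h : Subgroup.closure {g | ∃ x ≠ t, FreeGroup.of x = g}
      ≤ (magnusRep t).eqLocus (mulLeftHom X) := by
    rw [Subgroup.closure_le]
    rintro _ ⟨x, hx, rfl⟩
    change magnusRep t (FreeGroup.of x) = _
    simp [magnusRep, hx]
  exact h hu

/-- The weight filtration of `ℤ[F] × ℤ`. -/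
def magnusFiltration (X : Type*) (p : ℕ) : AddSubgroup (MonoidAlgebra ℤ (FreeGroup X) × ℤ) where
  carrier := {m | InWeight (fun _ => 1) (p - 1) m.1 ∧ (1 ≤ p → m.2 = 0)}
  add_mem' := by
    rintro a b ⟨ha, ha'⟩ ⟨hb, hb'⟩
    exact ⟨ha.add hb, fun h => by simp [ha' h, hb' h]⟩
  zero_mem' := ⟨.zero _, fun _ => rfl⟩
  neg_mem' := by
    rintro a ⟨ha, ha'⟩
    exact ⟨ha.neg, fun h => by simp [ha' h]⟩

/-- In `magnusRep` the vector (0, 1) goes under t⁻¹, u, t, u⁻¹ successively to (-1, 1), (-u, 1), (1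
- u, 1), (u⁻¹ - 1, 1). Acting by an element of the (j+1)-st dimension subgroup moves it by weight j
+ 1, which in the first coordinate means augmentation weight j. -/
theorem inv_mem_dimensionSubgroup_of_conj_mul_inv_mem {t : X} {j : ℕ} {u : FreeGroup X}
    (hu : u ∈ Subgroup.closure {g | ∃ x ≠ t, FreeGroup.of x = g})
    (h : u⁻¹ * FreeGroup.of t * u * (FreeGroup.of t)⁻¹
      ∈ dimensionSubgroup (fun _ => 1) (j + 1)) :
    u⁻¹ ∈ dimensionSubgroup (fun _ => 1) j := by
  have key := InWeight.lift_apply_mem (magnusFiltration X)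
    (fun p q hpq m hm => ⟨.mono (by omega) hm.1, fun h' => hm.2 (by omega)⟩) (magnusRep t)
    (by
      intro x p m hm
      by_cases hx : x = t
      · subst hx
        rw [magnusRep_of_self, transvectionHom_apply]
        refine ⟨?_, fun _ => sub_self _⟩
        -- For p = 0 the target weight (0 + 1) - 1 is 0, so nothing is required; for p > 0 the
        -- second coordinate vanishes and t acts trivially.
        rcases Nat.eq_zero_or_pos p with rfl | hp
        · exact .all _
        · simpa [hm.2 hp] using .zero _
      · rw [magnusRep_of_mem (Subgroup.subset_closure ⟨x, hx, rfl⟩), mulLeftHom_apply]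
        refine ⟨?_, fun _ => sub_self _⟩
        have := (InWeight.gen (w := fun _ => 1) x).mul hm.1
        rw [sub_mul, one_mul] at this
        exact .mono (by omega) this)
    (by
      intro x p m hm
      by_cases hx : x = t
      · subst hx
        rw [magnusRep_inv_of_self, transvectionHom_apply]
        refine ⟨?_, hm.2⟩
        rcases Nat.eq_zero_or_pos p with rfl | hp
        · exact .all _
        · simpa [hm.2 hp] using hm.1
      · rw [magnusRep_of_mem (inv_mem (Subgroup.subset_closure ⟨x, hx, rfl⟩)), mulLeftHom_apply]
        exact ⟨hm.1.mul_left _, hm.2⟩)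
    (mem_dimensionSubgroup.1 h) (p := 0) (m := (0, 1)) ⟨.all _, by simp⟩
  have key' := key.1
  rw [map_sub, MonoidAlgebra.lift_of, map_one (MonoidAlgebra.lift _ _ _ _), map_mul, map_mul,
    map_mul, magnusRep_of_mem hu, magnusRep_of_mem (inv_mem hu), magnusRep_of_self,
    magnusRep_inv_of_self] at key'
  simp only [LinearMap.sub_apply, Module.End.mul_apply, mulLeftHom_apply, transvectionHom_apply,
    Module.End.one_apply] at key'
  have e : of ℤ (FreeGroup X) u⁻¹ * (of ℤ _ u * (-1) + 1) = of ℤ _ u⁻¹ - 1 := by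
    rw [mul_add, ← mul_assoc, ← map_mul, inv_mul_cancel, map_one, mul_one, one_mul]
    abel
  rw [mem_dimensionSubgroup, ← e]
  simpa using key'

theorem mem_lcs_of_conj_mul_inv_mem [Finite X] {F : Type*} [Group F] (x : FreeGroupBasis X F)
    {t : X} {j : ℕ} {u : F} (hu : u ∈ Subgroup.closure {g | ∃ i ≠ t, x i = g})
    (h : u⁻¹ * x t * u * (x t)⁻¹ ∈ lcs (⊤ : Subgroup F) (j + 1)) :
    u ∈ lcs (⊤ : Subgroup F) j := by
  have hu' : x.repr u ∈ Subgroup.closure {g | ∃ i ≠ t, FreeGroup.of i = g} := by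
    have := Subgroup.mem_map_of_mem x.repr.toMonoidHom hu
    rw [MonoidHom.map_closure] at this
    refine Subgroup.closure_mono ?_ this
    rintro _ ⟨_, ⟨i, hi, rfl⟩, rfl⟩
    exact ⟨i, hi, (x.repr_apply_coe i).symm⟩
  have h' := lcs_le_dimensionSubgroup (by omega) (map_lcs_top_le x.repr.toMonoidHom _ h)
  have h'' : x.repr.toMonoidHom (u⁻¹ * x t * u * (x t)⁻¹) = (x.repr u)⁻¹ * FreeGroup.of t * x.repr u
      * (FreeGroup.of t)⁻¹ := by simp
  rw [h''] at h'
  have := map_lcs_top_le x.repr.symm.toMonoidHom j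
    (dimensionSubgroup_le_lcs j (inv_mem_dimensionSubgroup_of_conj_mul_inv_mem hu' h'))
  simpa using this

end Centralizer

end FreeGroupFiltration

/-! ### Automorphisms moving one basis element, and the factorization -/

section TriangularFactors

open scoped commutatorElement

variable {n : ℕ} {F : Type*} [Group F] (x : FreeGroupBasis (Fin n) F) (i : Fin n)

/-- The retraction of the free group onto the subgroup generated by the first basis elements. -/
def initialRetraction : F →* F :=
  (initialSubgroup x i).subtype.comp <| x.lift fun l =>
    if h : l < i then ⟨x l, Subgroup.subset_closure ⟨l, h, rfl⟩⟩ else 1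

variable {x i}

theorem FreeGroupBasis.lift_apply_basis {ι G H : Type*} [Group G] [Group H]
    (b : FreeGroupBasis ι G) (f : ι → H) (l : ι) : b.lift f (b l) = f l :=
  congrFun (b.lift.symm_apply_apply f) l

theorem initialRetraction_basis (l : Fin n) :
    initialRetraction x i (x l) = if l < i then x l else 1 := by
  rw [initialRetraction, MonoidHom.comp_apply, x.lift_apply_basis]
  split_ifs <;> rfl

theorem initialRetraction_mem (g : F) : initialRetraction x i g ∈ initialSubgroup x i :=
  SetLike.coe_mem _

theorem initialSubgroup_le_eqLocus {H : Type*} [Group H] {f g : F →* H}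
    (h : ∀ l < i, f (x l) = g (x l)) : initialSubgroup x i ≤ f.eqLocus g := by
  rw [initialSubgroup, Subgroup.closure_le]
  rintro _ ⟨l, hl, rfl⟩
  exact h l hl

theorem initialRetraction_of_mem {g : F} (hg : g ∈ initialSubgroup x i) :
    initialRetraction x i g = g :=
  initialSubgroup_le_eqLocus (g := MonoidHom.id F)
    (fun l hl => by rw [initialRetraction_basis, if_pos hl]; rfl) hg

theorem initialRetraction_mem_lcs {j : ℕ} {g : F} (hg : g ∈ lcs (⊤ : Subgroup F) j) :
    initialRetraction x i g ∈ lcs (initialSubgroup x i) j := by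
  have h := Subgroup.mem_map_of_mem (initialRetraction x i) hg
  rw [map_lcs] at h
  refine lcs_mono j ?_ h
  rintro _ ⟨g, -, rfl⟩
  exact initialRetraction_mem g

variable (x i)

/-- The endomorphism sending `x_i` to `u x_i v` and fixing the other basis elements. -/
def factorHom (u v : F) : F →* F := x.lift fun l => if l = i then u * x i * v else x l

variable {x i}

theorem factorHom_basis_self (u v : F) : factorHom x i u v (x i) = u * x i * v :=
  (x.lift_apply_basis _ i).trans (if_pos rfl)

theorem factorHom_basis_of_ne (u v : F) {l : Fin n} (hl : l ≠ i) :
    factorHom x i u v (x l) = x l :=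
  (x.lift_apply_basis _ l).trans (if_neg hl)

theorem factorHom_of_mem (u v : F) {g : F} (hg : g ∈ initialSubgroup x i) :
    factorHom x i u v g = g :=
  initialSubgroup_le_eqLocus (g := MonoidHom.id F)
    (fun _ hl => factorHom_basis_of_ne u v hl.ne) hg

/-- The outer map fixes u' and v', so left multipliers compose in reverse order and right
multipliers in order. -/
theorem factorHom_comp {u v u' v' : F} (hu' : u' ∈ initialSubgroup x i)
    (hv' : v' ∈ initialSubgroup x i) :
    (factorHom x i u v).comp (factorHom x i u' v') = factorHom x i (u' * u) (v * v') := by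
  refine x.ext_hom _ _ fun l => ?_
  rw [MonoidHom.comp_apply]
  by_cases hl : l = i
  · subst hl
    rw [factorHom_basis_self, map_mul, map_mul, factorHom_of_mem u v hu', factorHom_of_mem u v hv',
      factorHom_basis_self, factorHom_basis_self]
    group
  · rw [factorHom_basis_of_ne _ _ hl, factorHom_basis_of_ne _ _ hl, factorHom_basis_of_ne _ _ hl]

theorem factorHom_one_one : factorHom x i 1 1 = MonoidHom.id F := by
  refine x.ext_hom _ _ fun l => ?_
  by_cases hl : l = i
  · subst hl
    rw [factorHom_basis_self, one_mul, mul_one, MonoidHom.id_apply]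
  · rw [factorHom_basis_of_ne _ _ hl, MonoidHom.id_apply]

variable (x i)

/-- The automorphism sending `x_i` to `π(u) x_i π(v)` and fixing the other basis elements, where
`π` is the retraction onto the subgroup generated by the first basis elements. -/
def factorAut (u v : F) : MulAut F :=
  MonoidHom.toMulEquiv
    (factorHom x i (initialRetraction x i u) (initialRetraction x i v))
    (factorHom x i (initialRetraction x i u)⁻¹ (initialRetraction x i v)⁻¹)
    (by
      rw [factorHom_comp (initialRetraction_mem _) (initialRetraction_mem _), mul_inv_cancel,
        inv_mul_cancel, factorHom_one_one])
    (by
      rw [factorHom_comp (inv_mem (initialRetraction_mem _)) (inv_mem (initialRetraction_mem _)),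
        mul_inv_cancel, inv_mul_cancel, factorHom_one_one])

variable {x i}

theorem factorAut_apply (u v g : F) : factorAut x i u v g
    = factorHom x i (initialRetraction x i u) (initialRetraction x i v) g := rfl

theorem factorAut_mul (u v u' v' : F) :
    factorAut x i u v * factorAut x i u' v' = factorAut x i (u' * u) (v * v') := by
  ext g
  have h := factorHom_comp (u := initialRetraction x i u) (v := initialRetraction x i v)
    (initialRetraction_mem (x := x) (i := i) u') (initialRetraction_mem (x := x) (i := i) v')
  rw [← map_mul, ← map_mul] at h
  exact DFunLike.congr_fun h g

theorem factorAut_one_one : factorAut x i 1 1 = 1 := by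
  ext g
  rw [factorAut_apply, map_one, factorHom_one_one]
  rfl

theorem factorAut_inv (u v : F) : (factorAut x i u v)⁻¹ = factorAut x i u⁻¹ v⁻¹ := by
  rw [inv_eq_iff_mul_eq_one, factorAut_mul, inv_mul_cancel, mul_inv_cancel, factorAut_one_one]

theorem factorAut_mem_triangularIA {w γ : F} (hγ : γ ∈ lcs (initialSubgroup x i) 2) :
    factorAut x i w⁻¹ (w * γ) ∈ triangularIA x := by
  intro l
  by_cases hl : l = i
  · subst hl
    refine ⟨_, initialRetraction_mem w, γ, hγ, ?_⟩
    rw [factorAut_apply, factorHom_basis_self, map_inv, map_mul,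
      initialRetraction_of_mem (lcs_two_le _ hγ), ← mul_assoc]
  · refine ⟨1, one_mem _, 1, one_mem _, ?_⟩
    rw [factorAut_apply, factorHom_basis_of_ne _ _ hl]
    group

variable (x i)

/-- The action of `w` on the basis element `x_i` by `x_i ↦ w⁻¹ x_i w`. -/
def factorConj : F →* MulAut F where
  toFun w := factorAut x i w⁻¹ w
  map_one' := by rw [inv_one, factorAut_one_one]
  map_mul' a b := by rw [factorAut_mul, mul_inv_rev]

variable {x i}

theorem factorConj_mem_lcs {j : ℕ} {w : F} (hw : w ∈ lcs (initialSubgroup x i) j) :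
    factorConj x i w ∈ lcs (triangularIA x) j := by
  have h := Subgroup.mem_map_of_mem (factorConj x i) hw
  rw [map_lcs] at h
  refine lcs_mono j ?_ h
  rintro _ ⟨w, -, rfl⟩
  have := factorAut_mem_triangularIA (w := w) (one_mem (lcs (initialSubgroup x i) 2))
  rwa [mul_one] at this

theorem factorAut_commutatorElement (w γ : F) :
    ⁅factorAut x i 1 γ, factorConj x i w⁆ = factorAut x i 1 (⁅w, γ⁆⁻¹) := by
  change ⁅factorAut x i 1 γ, factorAut x i w⁻¹ w⁆ = _
  rw [commutatorElement_def, factorAut_inv, factorAut_inv, factorAut_mul, factorAut_mul,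
    factorAut_mul, commutatorElement_def]
  congr 1 <;> group

variable (x i)

/-- The action of `γ` on the basis element `x_i` by `x_i ↦ x_i γ`. -/
def factorTranslation : F →* MulAut F where
  toFun γ := factorAut x i 1 γ
  map_one' := factorAut_one_one
  map_mul' a b := by rw [factorAut_mul, one_mul]

variable {x i}

/-- The index shifts by one because a translation is only known to be triangular when γ ∈ Γ_2.
Commutators with the conjugations, which are triangular for every w, then raise both degrees
together. -/
theorem factorTranslation_mem_lcs {j : ℕ} (hj : 1 ≤ j) :
    lcs (initialSubgroup x i) (j + 1)
      ≤ (lcs (triangularIA x) j).comap (factorTranslation x i) := by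
  induction j, hj using Nat.le_induction with
  | base =>
    intro γ hγ
    have := factorAut_mem_triangularIA (w := 1) hγ
    rwa [inv_one, one_mul] at this
  | succ j hj ih =>
    rw [lcs_succ _ _ (by omega), Subgroup.commutator_le]
    intro γ hγ w hw
    have hγ' : factorTranslation x i γ ∈ lcs (triangularIA x) j := ih hγ
    have h := Subgroup.commutator_mem_commutator hγ' (factorConj_mem_lcs (x := x) (j := 1) hw)
    rw [lcs_one, ← lcs_succ _ _ hj] at h
    change factorAut x i 1 ⁅γ, w⁆ ∈ lcs (triangularIA x) (j + 1)
    rw [← commutatorElement_inv w γ, ← factorAut_commutatorElement]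
    exact h

/-- A factor of a triangular automorphism lying in the Andreadakis filtration. -/
theorem mem_lcs_of_conj_mul_mem_lcs {j : ℕ} {w γ : F} (hw : w ∈ initialSubgroup x i)
    (hγ : γ ∈ initialSubgroup x i)
    (h : (w⁻¹ * x i * w) * γ * (x i)⁻¹ ∈ lcs (⊤ : Subgroup F) (j + 1)) :
    w ∈ lcs (initialSubgroup x i) j ∧ γ ∈ lcs (initialSubgroup x i) (j + 1) := by
  -- The retraction kills x_i and fixes w and γ, so the hypothesis retracts to γ itself.
  have hγ' : γ ∈ lcs (initialSubgroup x i) (j + 1) := by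
    have := initialRetraction_mem_lcs (x := x) (i := i) h
    simpa only [map_mul, map_inv, initialRetraction_of_mem hw, initialRetraction_of_mem hγ,
      initialRetraction_basis, lt_irrefl, if_false, mul_one, inv_mul_cancel, one_mul, inv_one]
      using this
  refine ⟨?_, hγ'⟩
  have hγt := lcs_mono (j + 1) (le_top (a := initialSubgroup x i)) hγ'
  have h' : w⁻¹ * x i * w * (x i)⁻¹ ∈ lcs (⊤ : Subgroup F) (j + 1) := by
    have := mul_mem h (inv_mem ((lcs_top_normal (j + 1)).conj_mem γ hγt (x i)))
    convert this using 1
    group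
  have hw' : w ∈ Subgroup.closure {g | ∃ l ≠ i, x l = g} :=
    Subgroup.closure_mono (by
    rintro _ ⟨l, hl, rfl⟩
    exact ⟨l, hl.ne, rfl⟩) hw
  have := initialRetraction_mem_lcs (x := x) (i := i)
    (FreeGroupFiltration.mem_lcs_of_conj_mul_inv_mem x hw' h')
  rwa [initialRetraction_of_mem hw] at this

/-- Splitting off the factor at the first basis element possibly moved leaves an automorphism of the
same kind fixing one more; the factor is itself in Γ_j(IA⁺), hence in 𝒜_j, so the hypotheses
persist. -/
theorem mem_lcs_triangularIA_of_forall_lt {j : ℕ} (hj : 1 ≤ j) {m : ℕ} (hm : m ≤ n)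
    {φ : MulAut F} (hφ : φ ∈ triangularIA x) (hφj : φ ∈ andreadakis F j)
    (hfix : ∀ l : Fin n, l.1 < m → φ (x l) = x l) : φ ∈ lcs (triangularIA x) j := by
  induction hm using Nat.decreasingInduction generalizing φ with
  | self =>
    have : φ = 1 := by
      have h := x.ext_hom φ.toMonoidHom (MonoidHom.id F) fun l => hfix l l.2
      ext g
      exact DFunLike.congr_fun h g
    rw [this]
    exact one_mem _
  | of_succ m hm ih =>
    let i : Fin n := ⟨m, hm⟩
    obtain ⟨w, hw, γ, hγ, e⟩ := hφ i
    have h := mem_andreadakis_iff.1 hφj (x i)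
    rw [e] at h
    obtain ⟨hwj, hγj⟩ := mem_lcs_of_conj_mul_mem_lcs hw (lcs_two_le _ hγ) h
    set κ := factorAut x i w⁻¹ (w * γ) with hκ
    have hκj : κ ∈ lcs (triangularIA x) j := by
      have h1 := mul_mem (factorConj_mem_lcs hwj) (factorTranslation_mem_lcs hj hγj)
      have h2 : factorConj x i w * factorTranslation x i γ = κ :=
        (factorAut_mul _ _ _ _).trans (by rw [one_mul])
      rwa [h2] at h1
    have hκA : κ ∈ andreadakis F j :=
      lcs_torelliIA_le_andreadakis hj (lcs_mono j (triangularIA_le_torelliIA x) hκj)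
    have hφS : ∀ g ∈ initialSubgroup x i, φ g = g := fun g hg =>
      initialSubgroup_le_eqLocus (f := φ.toMonoidHom) (g := MonoidHom.id F)
        (fun l hl => hfix l hl) hg
    have key := ih (φ := φ * κ⁻¹)
      (mul_mem hφ (inv_mem (factorAut_mem_triangularIA hγ))) (mul_mem hφj (inv_mem hκA))
      (by
        intro l hl
        rw [hκ, factorAut_inv, MulAut.mul_apply, factorAut_apply]
        by_cases hli : l = i
        · subst hli
          have h1 := lcs_two_le _ hγ
          have h2 := inv_mem (mul_mem hw h1)
          -- Here κ⁻¹ x_i = w x_i (wγ)⁻¹, and φ fixes w and γ, words in the earlier basis elements;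
          -- so φ sends this back to x_i.
          rw [factorHom_basis_self, inv_inv, initialRetraction_of_mem hw,
            initialRetraction_of_mem h2, map_mul, map_mul, hφS w hw, hφS _ h2, e]
          group
        · rw [factorHom_basis_of_ne _ _ hli]
          refine hfix l ?_
          have : l.1 ≠ m := fun h => hli (Fin.ext h)
          omega)
    have := mul_mem key hκj
    rwa [inv_mul_cancel_right] at this

end TriangularFactors

/-- Let `F` be a free group with ordered basis `x_1, …, x_n`. For every `j ≥ 1`, the equalities
`Γ_j(IA_n^+) = Γ_j(IA_n) ∩ IA_n^+ = 𝒜_j ∩ IA_n^+ = 𝒜_j(IA_n^+, Γ_*(F))` hold, as subgroups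
of `Aut(F)`. -/
theorem theorem5p3 {n : ℕ} {F : Type*} [Group F] (x : FreeGroupBasis (Fin n) F)
    (j : ℕ) (hj : 1 ≤ j) :
    lcs (triangularIA x) j = lcs (torelliIA F) j ⊓ triangularIA x ∧
    lcs (torelliIA F) j ⊓ triangularIA x = andreadakis F j ⊓ triangularIA x ∧
    andreadakis F j ⊓ triangularIA x = relAndreadakis (triangularIA x) j := by

  have h1 : lcs (triangularIA x) j ≤ lcs (torelliIA F) j ⊓ triangularIA x :=
    le_inf (lcs_mono j (triangularIA_le_torelliIA x))
      ((lcs_antitone _ hj).trans (lcs_one _).le)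
  have h2 : lcs (torelliIA F) j ⊓ triangularIA x ≤ andreadakis F j ⊓ triangularIA x :=
    inf_le_inf_right _ (lcs_torelliIA_le_andreadakis hj)
  have h3 : andreadakis F j ⊓ triangularIA x ≤ lcs (triangularIA x) j := fun φ hφ =>
    mem_lcs_triangularIA_of_forall_lt hj (Nat.zero_le n) hφ.2 hφ.1
      fun l hl => absurd hl (Nat.not_lt_zero _)
  exact ⟨le_antisymm h1 (h2.trans h3), le_antisymm h2 (h3.trans h1),
    andreadakis_inf_eq_relAndreadakis _ hj⟩
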